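/- Let $X$ be a real random variable with a probability density $f_X$ with respect to Lebesgue measure, let $Y$ be a random variable with values in a measurable space $\mathcal Y$, and let the channel $P_{Y|X}(\cdot|x)$ have a jointly measurable density $f_{Y|X}(y|x)$ with respect to a $\sigma$-finite measure $\nu$ on $\mathcal Y$. Write $$f_{X|Y}(x|y)=\frac{f_{Y|X}(y|x)f_X(x)}{\int_{\mathbb R} f_{Y|X}(y|x')f_X(x')\,dx'}$$ for the posterior density and $\mathrm{mmse}(X|Y)=\mathbb E\big[(X-\mathbb E[X|Y])^2\big]$, and assume that $\mathbb E|X|<\infty$ and $\mathrm{mmse}(X|Y)<\infty$. For an integer $M\ge 2$ and $t>0$ put $u_k=kt$ $(0\le k\le M-1)$, let $P_{X-u_k}$ be the law of $X-u_k$, $\mu_t=\sum_{k=0}^{M-1}P_{X-u_k}$, and $p_k(x)=\frac{dP_{X-u_k}}{d\mu_t}(x)$. Let $P_e(x;t)$ be the minimum probability of error, over all measurable decision rules $\mathcal Y\to\{0,\dots,M-1\}$, in the $M$-ary hypothesis test $\mathcal H_k: Y\sim P_{Y|X}(\cdot|x+u_k)$ with $\Pr(\mathcal H_k)=p_k(x)$,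 and define the $M$-ary Ziv--Zakai bound (without valley filling) $$\mathsf{ZZ}(P_X,P_{Y|X},M)=\int_0^\infty \frac t2\cdot\frac{1}{M-1}\int P_e(x;t)\,d\mu_t(x)\,dt .$$ Then, for every integer $M\ge2$, $$\mathrm{mmse}(X|Y)=\mathsf{ZZ}(P_X,P_{Y|X},M)$$ if and only if, for $P_Y$-almost every $y\in\mathcal Y$, the posterior density $f_{X|Y}(\cdot|y)$ is unimodal and symmetric about its mode, up to modification on a Lebesgue-null set; that is, it agrees Lebesgue-almost everywhere with a function $g:\mathbb R\to[0,\infty]$ for which there is $m\in\mathbb R$ such that $g$ is non-decreasing on $(-\infty,m]$, non-increasing on $[m,\infty)$, and $g(m-s)=g(m+s)$ for all $s\in\mathbb R$. -/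

import Mathlib

open MeasureTheory ProbabilityTheory Set
open scoped ENNReal

namespace ZivZakai

/-- The minimum mean square error `E[(X - E[X|Y])²]`, as an element of `[0, ∞]`. -/
noncomputable def mmse {Ω 𝒴 : Type*} [MeasurableSpace Ω] [m𝒴 : MeasurableSpace 𝒴]
    (μ : Measure Ω) (X : Ω → ℝ) (Y : Ω → 𝒴) : ℝ≥0∞ :=
  ∫⁻ ω, ENNReal.ofReal ((X ω - (μ[X | m𝒴.comap Y]) ω) ^ 2) ∂μ

/-- Minimum probability of error in the `M`-ary hypothesis test `H k : Y ∼ Q k`, `Pr (H k) = p k`,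
over all (measurable) decision rules. -/
noncomputable def minErrorProb {𝒴 : Type*} [MeasurableSpace 𝒴] {M : ℕ}
    (p : Fin M → ℝ≥0∞) (Q : Fin M → Measure 𝒴) : ℝ≥0∞ :=
  ⨅ (φ : 𝒴 → Fin M) (_ : Measurable φ), ∑ k, p k * Q k {y | φ y ≠ k}

/-- The law of `X - u` when `X` has law `P`. -/
noncomputable def shiftLaw (P : Measure ℝ) (u : ℝ) : Measure ℝ :=
  P.map (fun x => x - u)

/-- The measure `μ_U = ∑ k, P_{X - u k}`. -/
noncomputable def shiftSum (P : Measure ℝ) {M : ℕ} (U : Fin M → ℝ) : Measure ℝ :=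
  ∑ k, shiftLaw P (U k)

/-- The prior probabilities `p k = (dP_{X - u k} / dμ_U) (x)`. -/
noncomputable def prior (P : Measure ℝ) {M : ℕ} (U : Fin M → ℝ) (x : ℝ) (k : Fin M) : ℝ≥0∞ :=
  (shiftLaw P (U k)).rnDeriv (shiftSum P U) x

/-- The function `h(t, M)`: the maximum over the collections `U = {u k}` with `u k = k t` (for a
scalar parameter this constraint leaves a single collection) of the integral against `μ_U` of the
minimum error probability of the test between the laws `P_{Y|X}(· | x + u k)` with prior
probabilities `prior P U x k`. -/
noncomputable def hFun {𝒴 : Type*} [MeasurableSpace 𝒴]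
    (P : Measure ℝ) (W : Kernel ℝ 𝒴) (M : ℕ) (t : ℝ) : ℝ≥0∞ :=
  ⨆ (U : Fin M → ℝ) (_ : ∀ k : Fin M, U k = ((k : ℕ) : ℝ) * t),
    ∫⁻ x, minErrorProb (prior P U x) (fun k => W (x + U k)) ∂(shiftSum P U)

/-- The `M`-ary Ziv–Zakai bound without valley filling,
`∫_0^∞ (t / 2) * h(t, M) / (M - 1) dt`, for a scalar parameter with law `P` and channel `W`. -/
noncomputable def ZZ {𝒴 : Type*} [MeasurableSpace 𝒴]
    (P : Measure ℝ) (W : Kernel ℝ 𝒴) (M : ℕ) : ℝ≥0∞ :=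
  ∫⁻ t in Ioi (0 : ℝ), ENNReal.ofReal (t / 2) * (hFun P W M t / ((M : ℝ≥0∞) - 1))

/-- The posterior density `f_{X|Y}(x | y) = f_{Y|X}(y | x) f_X(x) / f_Y(y)`, where
`f_Y(y) = ∫ f_{Y|X}(y | x') f_X(x') dx'`, `w x y = f_{Y|X}(y | x)`. -/
noncomputable def posteriorDensity {𝒴 : Type*}
    (fX : ℝ → ℝ≥0∞) (w : ℝ → 𝒴 → ℝ≥0∞) (y : 𝒴) (x : ℝ) : ℝ≥0∞ :=
  w x y * fX x / ∫⁻ x', w x' y * fX x'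

/-- `g` is unimodal with mode `m` (plateaus, and the value `∞` at `m`, are allowed). -/
def UnimodalAt (g : ℝ → ℝ≥0∞) (m : ℝ) : Prop :=
  MonotoneOn g (Iic m) ∧ AntitoneOn g (Ici m)

/-- `g` is symmetric about `m`. -/
def SymmetricAbout (g : ℝ → ℝ≥0∞) (m : ℝ) : Prop :=
  ∀ s, g (m - s) = g (m + s)

/-- The density `f`, which is determined up to Lebesgue-null sets, has a version that is unimodal
and symmetric about its mode. -/
def IsUnimodalSymmetricDensity (f : ℝ → ℝ≥0∞) : Prop :=
  ∃ (g : ℝ → ℝ≥0∞) (m : ℝ), f =ᵐ[volume] g ∧ UnimodalAt g m ∧ SymmetricAbout g m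

end ZivZakai

/-!
Write `f_y(x) = f_{Y|X}(y|x) f_X(x)` for the joint density at the observation `y`. Both sides are
mixtures over `y`, with respect to the reference measure `ν`, of functionals of `f_y`:

* the mean square error is the integral of the second moment of `f_y` about the posterior mean
  (`mmse_eq_lintegral`), which is the least of its second moments (`momentAbout_densityMean_le`);
* the Ziv–Zakai bound is the integral of `zzFunctional`, because the optimal test picks the
  hypothesis with the largest weight, so that the error density is `∑ k, f_y (x + k t)` minus its
  largest term (`minErrorProb_withDensity`, `ZZ_eq_lintegral`).

For a single density `f` and any point `a`, the second moment about `a` is the integral of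
`t / 2` times the mass at distance at least `t / 2` from `a` (`momentAbout_eq`). That mass, times
`M - 1`, is the error of the suboptimal rule that picks the point of `x, x + t, …, x + (M - 1) t`
nearest to `a` (`lintegral_nearestLoss`), whence the bound (`zzFunctional_le_momentAbout`). Equality
means that the nearest point almost always carries the largest value of `f`. This holds if `f` is
unimodal and symmetric about `a`. Conversely, progressions that begin or end next to `a` show
that `f` almost everywhere decreases with the distance to `a` (`ae_ae_le_of_momentAbout_le`), and
an essential supremum over the points further away is then a unimodal symmetric version of `f`
(`isUnimodalSymmetricDensity_of_ae_le`).

As the pointwise inequality holds for every `y` and the mean square error is finite, the integrals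
agree exactly when the two functionals agree for almost every `y`.
-/

namespace ZivZakai

/-! ### Leaving out one term of a finite sum -/

/-- The least of the sums obtained from `∑ k, v k` by leaving out one term, that is
`∑ k, v k - max_k v k`; this form avoids the truncated subtraction of `ℝ≥0∞`. -/
noncomputable def omitMin {N : ℕ} (v : Fin (N + 1) → ℝ≥0∞) : ℝ≥0∞ :=
  ⨅ j : Fin (N + 1), ∑ i : Fin N, v (j.succAbove i)

lemma omitMin_le {N : ℕ} (v : Fin (N + 1) → ℝ≥0∞) (j : Fin (N + 1)) :
    omitMin v ≤ ∑ i : Fin N, v (j.succAbove i) :=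
  iInf_le _ j

lemma measurable_omitMin {α : Type*} [MeasurableSpace α] {N : ℕ} {v : Fin (N + 1) → α → ℝ≥0∞}
    (hv : ∀ k, Measurable (v k)) : Measurable fun a => omitMin fun k => v k a :=
  Measurable.iInf fun _ => Finset.measurable_sum _ fun _ _ => hv _

lemma omitMin_const_mul {N : ℕ} (v : Fin (N + 1) → ℝ≥0∞) {c : ℝ≥0∞} (hc : c ≠ ∞) :
    omitMin (fun k => c * v k) = c * omitMin v := by
  simp_rw [omitMin, ← Finset.mul_sum]
  rw [ENNReal.mul_iInf fun h => absurd h hc]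

lemma omitMin_eq_of_forall_le {N : ℕ} {v : Fin (N + 1) → ℝ≥0∞} {j : Fin (N + 1)}
    (hv : ∀ k, v k ≤ v j) (hj : v j ≠ ∞) : omitMin v = ∑ i : Fin N, v (j.succAbove i) := by
  refine le_antisymm (omitMin_le v j) (le_iInf fun k => ?_)
  have h := (Fin.sum_univ_succAbove v j).symm.trans (Fin.sum_univ_succAbove v k)
  refine (ENNReal.add_le_add_iff_left hj).1 ?_
  rw [h]
  gcongr
  exact hv k

lemma le_of_omitMin_eq {N : ℕ} {v : Fin (N + 1) → ℝ≥0∞} {j : Fin (N + 1)} (hv : ∀ k, v k ≠ ∞)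
    (h : omitMin v = ∑ i : Fin N, v (j.succAbove i)) (k : Fin (N + 1)) : v k ≤ v j := by
  have h' := (Fin.sum_univ_succAbove v k).symm.trans (Fin.sum_univ_succAbove v j)
  refine (ENNReal.add_le_add_iff_right (a := ∑ i : Fin N, v (k.succAbove i))
    (ENNReal.sum_ne_top.2 fun i _ => hv _)).1 ?_
  rw [h', ← h]
  gcongr
  exact omitMin_le v k

lemma exists_forall_iff_castSucc_lt (N : ℕ) {p : ℕ → Prop} (hp : ∀ k, p (k + 1) → p k) :
    ∃ j : Fin (N + 1), ∀ i : Fin N, p i ↔ i.castSucc < j := by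
  classical
  have hex : ∃ n, n = N ∨ ¬ p n := ⟨N, Or.inl rfl⟩
  have hle : Nat.find hex ≤ N := Nat.find_min' hex (Or.inl rfl)
  have hp' : ∀ m n, m ≤ n → p n → p m := fun m n hmn =>
    Nat.le_induction (P := fun n _ => p n → p m) id (fun n _ ih h => ih (hp n h)) n hmn
  refine ⟨⟨Nat.find hex, Nat.lt_succ_of_le hle⟩, fun i => ?_⟩
  rw [Fin.lt_def]
  refine ⟨fun h => ?_, fun h => ?_⟩
  · by_contra hlt
    rcases Nat.find_spec hex with h1 | h1
    · have := i.2
      simp only [Fin.val_castSucc] at hlt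
      omega
    · exact h1 (hp' _ _ (not_lt.1 hlt) h)
  · have := Nat.find_min hex h
    push Not at this
    exact this.2

/-! ### The Ziv–Zakai functional of a density on the line -/

/-- The integral over `x` of the sum of `f x, f (x + t), …, f (x + N t)` minus their maximum: the
error of the optimal `(N + 1)`-ary test with spacing `t`, for a single density `f`. -/
noncomputable def overlap (N : ℕ) (f : ℝ → ℝ≥0∞) (t : ℝ) : ℝ≥0∞ :=
  ∫⁻ x, omitMin fun k : Fin (N + 1) => f (x + (k : ℕ) * t)

/-- The `(N + 1)`-ary Ziv–Zakai bound for a single (unnormalized) density. -/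
noncomputable def zzFunctional (N : ℕ) (f : ℝ → ℝ≥0∞) : ℝ≥0∞ :=
  ∫⁻ t in Ioi (0 : ℝ), ENNReal.ofReal (t / 2) * (overlap N f t / N)

/-- The second moment about `a` of the measure with density `f`. -/
noncomputable def momentAbout (a : ℝ) (f : ℝ → ℝ≥0∞) : ℝ≥0∞ :=
  ∫⁻ x, ENNReal.ofReal ((x - a) ^ 2) * f x

/-- The mass that `f` puts at distance at least `t / 2` from `a`. The point `a + t / 2`, of measure
zero, is excluded, so that after a shift by `t` the two half-lines are complementary. -/
noncomputable def tailMass (a : ℝ) (f : ℝ → ℝ≥0∞) (t : ℝ) : ℝ≥0∞ :=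
  (∫⁻ x in Iic (a - t / 2), f x) + ∫⁻ x in Ioi (a + t / 2), f x

/-- The error density of the rule that picks the point of the progression `x, x + t, …, x + N t`
nearest to `a`: with `x + j t` that point, it is the sum of the values of `f` at the others. -/
noncomputable def nearestLoss (N : ℕ) (f : ℝ → ℝ≥0∞) (a t x : ℝ) : ℝ≥0∞ :=
  ∑ i : Fin N, if x + (i : ℕ) * t ≤ a - t / 2 then f (x + (i : ℕ) * t)
    else f (x + ((i : ℕ) + 1 : ℕ) * t)

lemma exists_nearestLoss_eq (N : ℕ) (f : ℝ → ℝ≥0∞) (a : ℝ) {t : ℝ} (ht : 0 < t) (x : ℝ) :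
    ∃ j : Fin (N + 1), (∀ i : Fin N, x + (i : ℕ) * t ≤ a - t / 2 ↔ i.castSucc < j) ∧
      nearestLoss N f a t x = ∑ i : Fin N, f (x + (j.succAbove i : ℕ) * t) := by
  obtain ⟨j, hj⟩ := exists_forall_iff_castSucc_lt N (p := fun k => x + (k : ℕ) * t ≤ a - t / 2)
    (fun k h => by push_cast at h; linarith)
  refine ⟨j, hj, Finset.sum_congr rfl fun i _ => ?_⟩
  simp only [hj, Fin.succAbove]
  split_ifs <;> simp

lemma omitMin_le_nearestLoss (N : ℕ) (f : ℝ → ℝ≥0∞) (a : ℝ) {t : ℝ} (ht : 0 < t) (x : ℝ) :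
    omitMin (fun k : Fin (N + 1) => f (x + (k : ℕ) * t)) ≤ nearestLoss N f a t x := by
  obtain ⟨j, -, hj⟩ := exists_nearestLoss_eq N f a ht x
  rw [hj]
  exact omitMin_le _ j

lemma measurable_nearestLoss (N : ℕ) {f : ℝ → ℝ≥0∞} (hf : Measurable f) (a t : ℝ) :
    Measurable (nearestLoss N f a t) := by
  refine Finset.measurable_sum _ fun i _ => Measurable.ite ?_ (by fun_prop) (by fun_prop)
  exact measurableSet_le (by fun_prop) (by fun_prop)

lemma lintegral_nearestLoss (N : ℕ) {f : ℝ → ℝ≥0∞} (hf : Measurable f) (a t : ℝ) :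
    ∫⁻ x, nearestLoss N f a t x = N * tailMass a f t := by
  simp only [nearestLoss]
  have hterm : ∀ i : ℕ, ∫⁻ x, (if x + (i : ℕ) * t ≤ a - t / 2 then f (x + (i : ℕ) * t)
      else f (x + ((i : ℕ) + 1 : ℕ) * t)) = tailMass a f t := by
    intro i
    have h1 : ∀ x : ℝ, (if x + (i : ℕ) * t ≤ a - t / 2 then f (x + (i : ℕ) * t)
        else f (x + ((i : ℕ) + 1 : ℕ) * t)) =
        (Iic (a - t / 2)).indicator f (x + i * t) +
          (Ioi (a + t / 2)).indicator f (x + ((i : ℕ) + 1 : ℕ) * t) := by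
      intro x
      by_cases h : x + (i : ℕ) * t ≤ a - t / 2
      · have h2 : ¬ a + t / 2 < x + ((i : ℕ) + 1 : ℕ) * t := by push_cast; linarith
        simp only [h, if_true, indicator, mem_Iic, mem_Ioi, h2, if_false, add_zero]
      · have h2 : a + t / 2 < x + ((i : ℕ) + 1 : ℕ) * t := by push_cast; linarith
        simp only [h, indicator, mem_Iic, mem_Ioi, h2, if_false, if_true, zero_add]
    simp_rw [h1]
    have hm : Measurable fun x : ℝ => (Iic (a - t / 2)).indicator f (x + i * t) :=
      (hf.indicator measurableSet_Iic).comp (by fun_prop)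
    rw [lintegral_add_left hm,
      lintegral_add_right_eq_self (fun x => (Iic (a - t / 2)).indicator f x),
      lintegral_add_right_eq_self (fun x => (Ioi (a + t / 2)).indicator f x),
      lintegral_indicator measurableSet_Iic, lintegral_indicator measurableSet_Ioi, tailMass]
  rw [lintegral_finsetSum]
  · simp only [hterm]
    simp
  · intro i _
    exact Measurable.ite (measurableSet_le (by fun_prop) (by fun_prop)) (by fun_prop) (by fun_prop)

lemma overlap_le (N : ℕ) {f : ℝ → ℝ≥0∞} (hf : Measurable f) (a : ℝ) {t : ℝ} (ht : 0 < t) :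
    overlap N f t ≤ N * tailMass a f t := by
  rw [← lintegral_nearestLoss N hf]
  exact lintegral_mono fun x => omitMin_le_nearestLoss N f a ht x

lemma lintegral_half_tail (a x : ℝ) :
    ∫⁻ t in Ioi (0 : ℝ), ENNReal.ofReal (t / 2) *
      (if x ≤ a - t / 2 ∨ a + t / 2 < x then 1 else 0) = ENNReal.ofReal ((x - a) ^ 2) := by
  have hset : ∀ᵐ t : ℝ, t ∈ Ioi (0 : ℝ) → ENNReal.ofReal (t / 2) *
      (if x ≤ a - t / 2 ∨ a + t / 2 < x then 1 else 0) =
      (Ioc 0 (2 * |x - a|)).indicator (fun t => ENNReal.ofReal (t / 2)) t := by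
    have hne : ∀ᵐ t : ℝ, t ≠ 2 * |x - a| := by simp [ae_iff]
    filter_upwards [hne] with t hne ht
    simp only [mem_Ioi] at ht
    have : (x ≤ a - t / 2 ∨ a + t / 2 < x) ↔ t ≤ 2 * |x - a| := by
      constructor
      · rintro (h | h)
        · have := neg_le_abs (x - a); linarith
        · have := le_abs_self (x - a); linarith
      · intro h
        have h := lt_of_le_of_ne h hne
        rcases abs_cases (x - a) with ⟨h1, h2⟩ | ⟨h1, h2⟩
        · right; linarith
        · left; linarith
    simp [indicator, this, ht]
  rw [setLIntegral_congr_fun_ae measurableSet_Ioi hset, lintegral_indicator measurableSet_Ioc,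
    Measure.restrict_restrict measurableSet_Ioc,
    inter_eq_left.2 (Ioc_subset_Ioi_self : Ioc 0 (2 * |x - a|) ⊆ Ioi (0 : ℝ)),
    ← ofReal_integral_eq_lintegral_ofReal, ← intervalIntegral.integral_of_le (by positivity)]
  · congr 1
    rw [intervalIntegral.integral_div, integral_id]
    nlinarith [sq_abs (x - a)]
  · exact (by fun_prop : Continuous fun t : ℝ => t / 2).integrableOn_Ioc
  · filter_upwards [ae_restrict_mem measurableSet_Ioc] with t ht
    exact (half_pos ht.1).le

lemma tailMass_eq_lintegral {f : ℝ → ℝ≥0∞} (a : ℝ) {t : ℝ} (ht : 0 < t) :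
    tailMass a f t = ∫⁻ x, (if x ≤ a - t / 2 ∨ a + t / 2 < x then 1 else 0) * f x := by
  have hd : Disjoint (Iic (a - t / 2)) (Ioi (a + t / 2)) := by
    rw [Set.disjoint_left]
    intro x hx hx'
    simp only [mem_Iic, mem_Ioi] at hx hx'
    linarith
  rw [tailMass, ← lintegral_union measurableSet_Ioi hd,
    ← lintegral_indicator (measurableSet_Iic.union measurableSet_Ioi)]
  refine lintegral_congr fun x => ?_
  simp [indicator]

/-- The layer-cake formula for the second moment about `a`. -/
lemma momentAbout_eq {f : ℝ → ℝ≥0∞} (hf : Measurable f) (a : ℝ) :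
    momentAbout a f = ∫⁻ t in Ioi (0 : ℝ), ENNReal.ofReal (t / 2) * tailMass a f t := by
  have hind : Measurable fun p : ℝ × ℝ =>
      (if p.1 ≤ a - p.2 / 2 ∨ a + p.2 / 2 < p.1 then 1 else 0 : ℝ≥0∞) := by
    have h1 : MeasurableSet {p : ℝ × ℝ | p.1 ≤ a - p.2 / 2} :=
      measurableSet_le (by fun_prop) (by fun_prop)
    have h2 : MeasurableSet {p : ℝ × ℝ | a + p.2 / 2 < p.1} :=
      measurableSet_lt (by fun_prop) (by fun_prop)
    exact Measurable.ite (h1.union h2) (by fun_prop) (by fun_prop)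
  have hind1 : ∀ x, Measurable fun t : ℝ =>
      (if x ≤ a - t / 2 ∨ a + t / 2 < x then 1 else 0 : ℝ≥0∞) := fun x =>
    hind.comp measurable_prodMk_left
  have hind2 : ∀ t, Measurable fun x : ℝ =>
      (if x ≤ a - t / 2 ∨ a + t / 2 < x then 1 else 0 : ℝ≥0∞) := fun t =>
    hind.comp measurable_prodMk_right
  calc momentAbout a f
      = ∫⁻ x, ∫⁻ t in Ioi (0 : ℝ), ENNReal.ofReal (t / 2) *
          (if x ≤ a - t / 2 ∨ a + t / 2 < x then 1 else 0) * f x := by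
        refine lintegral_congr fun x => ?_
        rw [← lintegral_half_tail, lintegral_mul_const]
        exact Measurable.mul (by fun_prop) (hind1 x)
    _ = ∫⁻ t in Ioi (0 : ℝ), ∫⁻ x, ENNReal.ofReal (t / 2) *
          (if x ≤ a - t / 2 ∨ a + t / 2 < x then 1 else 0) * f x := by
        refine lintegral_lintegral_swap (Measurable.aemeasurable ?_)
        exact Measurable.mul (Measurable.mul (by fun_prop) hind) (by fun_prop)
    _ = _ := by
        refine setLIntegral_congr_fun measurableSet_Ioi fun t ht => ?_
        simp only [mul_assoc]
        rw [lintegral_const_mul _ (Measurable.fun_mul (hind2 t) hf), tailMass_eq_lintegral a ht]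

lemma zzFunctional_le_momentAbout (N : ℕ) {f : ℝ → ℝ≥0∞} (hf : Measurable f) (a : ℝ) :
    zzFunctional N f ≤ momentAbout a f := by
  rw [momentAbout_eq hf]
  refine setLIntegral_mono' measurableSet_Ioi fun t ht => ?_
  gcongr
  exact ENNReal.div_le_of_le_mul' (overlap_le N hf a ht)

/-! ### Unimodal symmetric densities attain the second moment -/

lemma IsUnimodalSymmetricDensity.const_mul {f : ℝ → ℝ≥0∞} (hf : IsUnimodalSymmetricDensity f)
    (c : ℝ≥0∞) : IsUnimodalSymmetricDensity fun x => c * f x := by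
  obtain ⟨g, m, hfg, ⟨h1, h2⟩, h3⟩ := hf
  refine ⟨fun x => c * g x, m, ?_, ⟨fun x hx y hy h => ?_, fun x hx y hy h => ?_⟩, fun s => ?_⟩
  · filter_upwards [hfg] with x hx
    rw [hx]
  · exact mul_le_mul_right (h1 hx hy h) c
  · exact mul_le_mul_right (h2 hx hy h) c
  · simp only [h3 s]

lemma le_of_abs_sub_le {g : ℝ → ℝ≥0∞} {m : ℝ} (hg : UnimodalAt g m) (hs : SymmetricAbout g m)
    {x y : ℝ} (h : |x - m| ≤ |y - m|) : g y ≤ g x := by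
  have habs : ∀ z, g z = g (m + |z - m|) := by
    intro z
    rcases abs_cases (z - m) with ⟨h1, _⟩ | ⟨h1, _⟩
    · rw [h1]; congr 1; ring
    · rw [h1, ← hs]; congr 1; ring
  rw [habs x, habs y]
  exact hg.2 (by simp) (by simp) (by linarith)

lemma ae_forall_add_mul {p : ℝ → Prop} (hp : ∀ᵐ x, p x) (t : ℝ) :
    ∀ᵐ x, ∀ k : ℕ, p (x + k * t) :=
  ae_all_iff.2 fun k => (quasiMeasurePreserving_add_right volume ((k : ℝ) * t)).ae hp

lemma overlap_eq_of_unimodal (N : ℕ) {f g : ℝ → ℝ≥0∞} (hf : Measurable f)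
    (hfin : ∀ᵐ x, f x ≠ ∞) {m : ℝ} (hfg : f =ᵐ[volume] g) (hg : UnimodalAt g m)
    (hs : SymmetricAbout g m) {t : ℝ} (ht : 0 < t) : overlap N f t = N * tailMass m f t := by
  rw [← lintegral_nearestLoss N hf, overlap]
  refine lintegral_congr_ae ?_
  filter_upwards [ae_forall_add_mul hfg t, ae_forall_add_mul hfin t] with x hx hx'
  obtain ⟨j, hj, hsum⟩ := exists_nearestLoss_eq N f m ht x
  rw [hsum]
  refine omitMin_eq_of_forall_le (fun k => ?_) (hx' _)
  rw [hx, hx]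
  refine le_of_abs_sub_le hg hs ?_
  rcases lt_trichotomy k j with hkj | rfl | hkj
  · -- the predecessor of `j` still lies to the left of `m - t / 2`
    obtain ⟨i, hi⟩ : ∃ i : ℕ, (j : ℕ) = i + 1 :=
      ⟨(j : ℕ) - 1, by have : (k : ℕ) < j := hkj; omega⟩
    have hiN : i < N := by have := j.2; omega
    have h1 := (hj ⟨i, hiN⟩).2 (by rw [Fin.lt_def]; simp [hi])
    have hki : (k : ℝ) ≤ i := by
      have : (k : ℕ) < j := hkj
      exact_mod_cast (by omega : (k : ℕ) ≤ i)
    simp only at h1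
    have h2 : (k : ℝ) * t ≤ i * t := by gcongr
    rw [hi, abs_of_nonpos (a := x + (k : ℕ) * t - m) (by linarith)]
    push_cast
    exact abs_le.2 ⟨by linarith, by linarith⟩
  · exact le_rfl
  · have hjN : (j : ℕ) < N := by
      have h1 : (j : ℕ) < k := hkj
      have := k.2
      omega
    have h1 := mt (hj ⟨j, hjN⟩).1 (by rw [Fin.lt_def]; simp)
    have hjk : (j : ℝ) + 1 ≤ k := by exact_mod_cast (show (j : ℕ) < k from hkj)
    simp only [not_le] at h1
    have h2 : ((j : ℝ) + 1) * t ≤ k * t := by gcongr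
    rw [abs_of_nonneg (a := x + (k : ℕ) * t - m) (by linarith)]
    exact abs_le.2 ⟨by linarith, by linarith⟩

lemma zzFunctional_eq_of_unimodal {N : ℕ} (hN : N ≠ 0) {f g : ℝ → ℝ≥0∞} (hf : Measurable f)
    (hfin : ∀ᵐ x, f x ≠ ∞) {m : ℝ} (hfg : f =ᵐ[volume] g) (hg : UnimodalAt g m)
    (hs : SymmetricAbout g m) : zzFunctional N f = momentAbout m f := by
  rw [momentAbout_eq hf]
  refine setLIntegral_congr_fun measurableSet_Ioi fun t ht => ?_
  rw [overlap_eq_of_unimodal N hf hfin hfg hg hs ht,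
    mul_comm (N : ℝ≥0∞),
    ENNReal.mul_div_cancel_right (Nat.cast_ne_zero.2 hN) (ENNReal.natCast_ne_top N)]

/-! ### Densities attaining the second moment are unimodal and symmetric -/

/-- A function that almost everywhere decreases with the distance to `a` has a unimodal symmetric
version: the value of this version at `x` is the essential supremum of `f` over the points further
from `a` than `x`, which is a monotone function of `|x - a|` and so continuous off a countable
set of distances. -/
lemma isUnimodalSymmetricDensity_of_ae_le {f : ℝ → ℝ≥0∞} {a : ℝ}
    (h : ∀ᵐ x, ∀ᵐ y, |x - a| < |y - a| → f y ≤ f x) : IsUnimodalSymmetricDensity f := by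
  set A : ℝ → Set ℝ := fun r => {q | r < |q - a|}
  have hAm : ∀ r, MeasurableSet (A r) := fun r => measurableSet_lt (by fun_prop) (by fun_prop)
  set φ : ℝ → ℝ≥0∞ := fun r => essSup f (volume.restrict (A r))
  have hφ : Antitone φ := fun r s hrs =>
    essSup_mono_measure' (Measure.restrict_mono (fun q hq => lt_of_le_of_lt hrs hq) le_rfl)
  have hle : ∀ r, ∀ᵐ q, r < |q - a| → f q ≤ φ r := fun r =>
    (ae_restrict_iff' (hAm r)).1 (ae_le_essSup (f := f))
  -- rational radii suffice, by monotonicity of `φ`, and give a single null set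
  have hleQ : ∀ᵐ q, ∀ r : ℚ, (r : ℝ) < |q - a| → f q ≤ φ r := ae_all_iff.2 fun r => hle r
  have hcont : ∀ᵐ x : ℝ, ContinuousAt φ |x - a| := by
    have hc := hφ.countable_not_continuousAt
    have hc' : {x : ℝ | ¬ ContinuousAt φ |x - a|}.Countable := by
      have hsub : {x : ℝ | ¬ ContinuousAt φ |x - a|} ⊆
          (fun r => a + r) '' {r | ¬ ContinuousAt φ r} ∪
            (fun r => a - r) '' {r | ¬ ContinuousAt φ r} := by
        intro x hx
        rcases abs_cases (x - a) with ⟨h, _⟩ | ⟨h, _⟩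
        · exact Or.inl ⟨|x - a|, hx, by simp only [h]; ring⟩
        · exact Or.inr ⟨|x - a|, hx, by simp only [h]; ring⟩
      exact ((hc.image _).union (hc.image _)).mono hsub
    exact hc'.measure_zero volume
  refine ⟨fun x => φ |x - a|, a, ?_, ⟨fun x hx y hy hxy => hφ ?_, fun x hx y hy hxy => hφ ?_⟩,
    fun s => ?_⟩
  · filter_upwards [h, hleQ, hcont] with x hx1 hx2 hx3
    refine le_antisymm ?_ (essSup_le_of_ae_le _ ((ae_restrict_iff' (hAm _)).2 hx1))
    have hlim : Filter.Tendsto φ (nhdsWithin |x - a| (Iio |x - a|)) (nhds (φ |x - a|)) :=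
      hx3.tendsto.mono_left nhdsWithin_le_nhds
    refine ge_of_tendsto hlim (eventually_nhdsWithin_of_forall fun r hr => ?_)
    obtain ⟨q, hq1, hq2⟩ := exists_rat_btwn (mem_Iio.1 hr)
    exact (hx2 q hq2).trans (hφ hq1.le)
  · rw [abs_of_nonpos (by simpa using hy), abs_of_nonpos (by simpa using hx)]
    linarith
  · rw [abs_of_nonneg (by simpa using hx), abs_of_nonneg (by simpa using hy)]
    linarith
  · simp

/-- If `f` attains its second moment about `a`, then for almost every pair of points `x`, `x + t`
the value of `f` at the one nearer to `a` is the larger one. -/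
lemma ae_ae_le_of_momentAbout_le {N : ℕ} (hN : N ≠ 0) {f : ℝ → ℝ≥0∞} (hf : Measurable f)
    (hfin : ∫⁻ x, f x ≠ ∞) {a : ℝ} (hV : zzFunctional N f ≠ ∞)
    (hle : momentAbout a f ≤ zzFunctional N f) :
    ∀ᵐ t : ℝ, 0 < t → ∀ᵐ x, (a - t / 2 < x → f (x + t) ≤ f x) ∧
      (x ≤ a - t / 2 → f x ≤ f (x + t)) := by
  have hfx : ∀ᵐ x, f x ≠ ∞ := (ae_lt_top hf hfin).mono fun x hx => hx.ne
  have htail : Measurable (tailMass a f) := by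
    refine Antitone.measurable fun s t hst => ?_
    refine add_le_add (lintegral_mono_set (Iic_subset_Iic.2 ?_))
      (lintegral_mono_set (Ioi_subset_Ioi ?_)) <;> linarith
  have htail_fin : ∀ t, tailMass a f t ≠ ∞ := fun t =>
    ENNReal.add_ne_top.2 ⟨ne_top_of_le_ne_top hfin (setLIntegral_le_lintegral _ _),
      ne_top_of_le_ne_top hfin (setLIntegral_le_lintegral _ _)⟩
  have hN0 : (N : ℝ≥0∞) ≠ 0 := Nat.cast_ne_zero.2 hN
  have hNtop : (N : ℝ≥0∞) ≠ ∞ := ENNReal.natCast_ne_top N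
  rw [momentAbout_eq hf] at hle
  have heq := ae_eq_of_ae_le_of_lintegral_le (ae_restrict_of_forall_mem measurableSet_Ioi
    fun t ht => mul_le_mul_right (ENNReal.div_le_of_le_mul' (overlap_le N hf a ht)) _) hV
    (Measurable.aemeasurable (by fun_prop)) hle
  filter_upwards [(ae_restrict_iff' measurableSet_Ioi).1 heq] with t heq ht
  have hov : N * tailMass a f t = overlap N f t := by
    have h1 := heq ht
    rw [ENNReal.mul_right_inj (by simpa using ht) ENNReal.ofReal_ne_top] at h1
    rw [← h1, ENNReal.mul_div_cancel hN0 hNtop]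
  have hfin' : overlap N f t ≠ ∞ := by
    rw [← hov]
    exact ENNReal.mul_ne_top hNtop (htail_fin t)
  rw [← lintegral_nearestLoss N hf] at hov
  have hx := ae_eq_of_ae_le_of_lintegral_le (Filter.Eventually.of_forall fun x =>
    omitMin_le_nearestLoss N f a ht x) hfin' (measurable_nearestLoss N hf a t).aemeasurable hov.le
  have hmax : ∀ᵐ x, ∃ j : Fin (N + 1),
      (∀ i : Fin N, x + (i : ℕ) * t ≤ a - t / 2 ↔ i.castSucc < j) ∧
      ∀ k : Fin (N + 1), f (x + (k : ℕ) * t) ≤ f (x + (j : ℕ) * t) := by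
    filter_upwards [hx, ae_forall_add_mul hfx t] with x hx hx'
    obtain ⟨j, hj, hsum⟩ := exists_nearestLoss_eq N f a ht x
    exact ⟨j, hj, le_of_omitMin_eq (v := fun k : Fin (N + 1) => f (x + (k : ℕ) * t))
      (fun k => hx' k) (hx.trans hsum)⟩
  -- the pair `x`, `x + t` opens the progression from `x` when `x` is the nearer point, and closes
  -- the progression from `x - (N - 1) t` when `x + t` is
  filter_upwards [hmax, (quasiMeasurePreserving_add_right volume (-((N : ℝ) - 1) * t)).ae hmax]
    with x ⟨j, hj, hmx⟩ ⟨j', hj', hmx'⟩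
  constructor
  · intro hxa
    have h0 : j = 0 := by
      have h := mt (hj ⟨0, Nat.pos_of_ne_zero hN⟩).2 (by simpa using hxa)
      rw [Fin.lt_def] at h
      ext
      simpa using h
    have h := hmx ⟨1, by omega⟩
    simpa [h0] using h
  · intro hxa
    have hcast : (((N - 1 : ℕ)) : ℝ) = (N : ℝ) - 1 := by
      rw [Nat.cast_sub (Nat.one_le_iff_ne_zero.2 hN), Nat.cast_one]
    have hN' : (j' : ℕ) = N := by
      have h := (hj' ⟨N - 1, by omega⟩).1 (by simp only [hcast]; linarith)
      rw [Fin.lt_def] at h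
      have h2 := j'.2
      simp only [Fin.val_castSucc] at h
      omega
    have h := hmx' ⟨N - 1, by omega⟩
    simp only [hcast, hN'] at h
    convert h using 2 <;> ring

lemma isUnimodalSymmetricDensity_of_momentAbout_le {N : ℕ} (hN : N ≠ 0) {f : ℝ → ℝ≥0∞}
    (hf : Measurable f) (hfin : ∫⁻ x, f x ≠ ∞) {a : ℝ} (hV : zzFunctional N f ≠ ∞)
    (hle : momentAbout a f ≤ zzFunctional N f) : IsUnimodalSymmetricDensity f := by
  refine isUnimodalSymmetricDensity_of_ae_le (a := a) ?_
  have hpos := ae_ae_le_of_momentAbout_le hN hf hfin hV hle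
  have h : ∀ᵐ t : ℝ, ∀ᵐ x, |x - a| < |x + t - a| → f (x + t) ≤ f x := by
    -- a pair with `t < 0` is the pair with `-t` read from its other end
    have hneg := (Measure.measurePreserving_neg (volume : Measure ℝ)).quasiMeasurePreserving.ae hpos
    have hne : ∀ᵐ t : ℝ, t ≠ 0 := by simp [ae_iff]
    filter_upwards [hpos, hneg, hne] with t hp hn hne
    rcases hne.lt_or_gt with ht | ht
    · filter_upwards [(quasiMeasurePreserving_add_right volume t).ae (hn (by linarith))]
        with x hx hxa
      have hx2 := hx.2
      rw [add_neg_cancel_right] at hx2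
      refine hx2 ?_
      have := sq_lt_sq.2 hxa
      nlinarith
    · filter_upwards [hp ht] with x hx hxa
      refine hx.1 ?_
      have := sq_lt_sq.2 hxa
      nlinarith
  rw [Measure.ae_ae_comm] at h
  · filter_upwards [h] with x hx
    filter_upwards [(quasiMeasurePreserving_add_right volume (-x)).ae hx] with y hy hxy
    have hxy' : x + (y + -x) = y := by ring
    rw [hxy'] at hy
    exact hy hxy
  · have h1 : MeasurableSet {p : ℝ × ℝ | |p.2 - a| < |p.2 + p.1 - a|} :=
      measurableSet_lt (by fun_prop) (by fun_prop)
    have h2 : MeasurableSet {p : ℝ × ℝ | f (p.2 + p.1) ≤ f p.2} :=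
      measurableSet_le (by fun_prop) (by fun_prop)
    exact h1.imp h2

/-! ### The minimum error probability as an integral -/

lemma exists_measurable_argmin {𝒴 : Type*} [MeasurableSpace 𝒴] {N : ℕ}
    {G : Fin (N + 1) → 𝒴 → ℝ≥0∞} (hG : ∀ k, Measurable (G k)) :
    ∃ φ : 𝒴 → Fin (N + 1), Measurable φ ∧ ∀ y k, G (φ y) y ≤ G k y := by
  classical
  have hex : ∀ y, ∃ n, ∃ h : n < N + 1, ∀ k, G ⟨n, h⟩ y ≤ G k y := fun y => by
    obtain ⟨j, hj⟩ := Finite.exists_min fun k => G k y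
    exact ⟨j, j.2, hj⟩
  have hm : Measurable fun y => Nat.find (hex y) := by
    refine measurable_find hex fun n => ?_
    by_cases h : n < N + 1
    · simp only [h, exists_true_left, ofPred_forall]
      exact MeasurableSet.iInter fun k => measurableSet_le (hG _) (hG k)
    · simp [h]
  refine ⟨fun y => ⟨Nat.find (hex y), (Nat.find_spec (hex y)).1⟩,
    measurable_to_countable' fun j => ?_, fun y => (Nat.find_spec (hex y)).2⟩
  convert hm (measurableSet_singleton (j : ℕ)) using 1
  ext y
  simp [Fin.ext_iff]

/-- The optimal decision rule picks a hypothesis with the largest posterior weight. -/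
lemma minErrorProb_withDensity {𝒴 : Type*} [MeasurableSpace 𝒴] {N : ℕ} (ν : Measure 𝒴)
    (p : Fin (N + 1) → ℝ≥0∞) {q : Fin (N + 1) → 𝒴 → ℝ≥0∞} (hq : ∀ k, Measurable (q k)) :
    minErrorProb p (fun k => ν.withDensity (q k)) =
      ∫⁻ y, omitMin (fun k => p k * q k y) ∂ν := by
  have hrule : ∀ φ : 𝒴 → Fin (N + 1), Measurable φ →
      ∑ k, p k * ν.withDensity (q k) {y | φ y ≠ k} =
        ∫⁻ y, ∑ i : Fin N, p ((φ y).succAbove i) * q ((φ y).succAbove i) y ∂ν := by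
    intro φ hφ
    have hset : ∀ k, MeasurableSet {y | φ y ≠ k} := fun k =>
      (hφ (measurableSet_singleton k)).compl
    have hterm : ∀ k, p k * ν.withDensity (q k) {y | φ y ≠ k} =
        ∫⁻ y, p k * ({y | φ y ≠ k}.indicator (q k) y) ∂ν := by
      intro k
      rw [withDensity_apply _ (hset k), ← lintegral_indicator (hset k),
        lintegral_const_mul _ ((hq k).indicator (hset k))]
    simp_rw [hterm]
    rw [← lintegral_finsetSum]
    · refine lintegral_congr fun y => ?_
      rw [Fin.sum_univ_succAbove _ (φ y)]
      simp [indicator, Fin.ne_succAbove]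
    · exact fun k _ => ((hq k).indicator (hset k)).const_mul _
  refine le_antisymm ?_ (le_iInf₂ fun φ hφ => ?_)
  · obtain ⟨φ, hφ, hmin⟩ := exists_measurable_argmin (N := N)
      (G := fun j y => ∑ i : Fin N, p (j.succAbove i) * q (j.succAbove i) y)
      fun j => Finset.measurable_sum _ fun i _ => (hq _).const_mul _
    refine (iInf₂_le φ hφ).trans ?_
    rw [hrule φ hφ]
    exact lintegral_mono fun y => le_iInf fun k => hmin y k
  · rw [hrule φ hφ]
    exact lintegral_mono fun y => omitMin_le _ (φ y)

/-! ### The Ziv–Zakai bound as a mixture over the observations -/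

lemma shiftLaw_withDensity {fX : ℝ → ℝ≥0∞} (u : ℝ) :
    shiftLaw (volume.withDensity fX) u = volume.withDensity fun x => fX (x + u) := by
  have hm : Measurable fun x : ℝ => x - u := by fun_prop
  ext s hs
  rw [shiftLaw, Measure.map_apply hm hs, withDensity_apply _ (hm hs), withDensity_apply _ hs,
    ← lintegral_indicator hs, ← lintegral_indicator (hm hs),
    ← lintegral_add_right_eq_self _ u]
  refine lintegral_congr fun x => ?_
  have h : x + u ∈ (fun x => x - u) ⁻¹' s ↔ x ∈ s := by
    rw [mem_preimage, add_sub_cancel_right]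
  by_cases hx : x ∈ s
  · rw [indicator_of_mem hx, indicator_of_mem (h.2 hx)]
  · rw [indicator_of_notMem hx, indicator_of_notMem (mt h.1 hx)]

lemma shiftSum_withDensity {fX : ℝ → ℝ≥0∞} (hfX : Measurable fX) {M : ℕ} (U : Fin M → ℝ) :
    shiftSum (volume.withDensity fX) U = volume.withDensity fun x => ∑ k, fX (x + U k) := by
  ext s hs
  rw [shiftSum, Measure.finsetSum_apply, withDensity_apply _ hs, lintegral_finsetSum]
  · simp_rw [shiftLaw_withDensity, withDensity_apply _ hs]
  · intro k _
    fun_prop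

/-- Weighted by the density of `shiftSum`, the prior probabilities are the shifted densities; the
points where `shiftSum` has density zero need no exception. -/
lemma sum_mul_prior_ae_eq {fX : ℝ → ℝ≥0∞} (hfX : Measurable fX) (hfin : ∫⁻ x, fX x ≠ ∞)
    {M : ℕ} (U : Fin M → ℝ) (k : Fin M) :
    ∀ᵐ x, (∑ j, fX (x + U j)) * prior (volume.withDensity fX) U x k = fX (x + U k) := by
  have hfinite : IsFiniteMeasure (volume.withDensity fX) := isFiniteMeasure_withDensity hfin
  have hlaw : ∀ j, IsFiniteMeasure (shiftLaw (volume.withDensity fX) (U j)) := fun j => by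
    unfold shiftLaw; infer_instance
  have hsum : IsFiniteMeasure (shiftSum (volume.withDensity fX) U) := by
    unfold shiftSum; infer_instance
  have hac : shiftLaw (volume.withDensity fX) (U k) ≪ shiftSum (volume.withDensity fX) U := by
    refine Measure.absolutelyContinuous_of_le (Measure.le_iff.2 fun s _ => ?_)
    rw [shiftSum, Measure.finsetSum_apply]
    exact Finset.single_le_sum (f := fun j => shiftLaw (volume.withDensity fX) (U j) s)
      (fun _ _ => zero_le) (Finset.mem_univ k)
  have h := Measure.withDensity_rnDeriv_eq _ _ hac
  have hr : Measurable fun x => prior (volume.withDensity fX) U x k :=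
    Measure.measurable_rnDeriv _ _
  have hS : Measurable fun x => ∑ j, fX (x + U j) := by fun_prop
  change (shiftSum (volume.withDensity fX) U).withDensity
    (fun x => prior (volume.withDensity fX) U x k) = _ at h
  nth_rw 1 [shiftSum_withDensity hfX] at h
  rw [shiftLaw_withDensity, ← withDensity_mul _ hS hr,
    withDensity_eq_iff_of_sigmaFinite (hS.mul hr).aemeasurable
      (by fun_prop)] at h
  exact h

lemma lintegral_minErrorProb_shiftSum {𝒴 : Type*} [MeasurableSpace 𝒴] {W : Kernel ℝ 𝒴}
    {ν : Measure 𝒴} [SigmaFinite ν] {w : ℝ → 𝒴 → ℝ≥0∞} (hw : Measurable (Function.uncurry w))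
    (hW : ∀ x, W x = ν.withDensity (w x)) {fX : ℝ → ℝ≥0∞} (hfX : Measurable fX)
    (hfin : ∫⁻ x, fX x ≠ ∞) {N : ℕ} (U : Fin (N + 1) → ℝ) :
    ∫⁻ x, minErrorProb (prior (volume.withDensity fX) U x) (fun k => W (x + U k))
        ∂(shiftSum (volume.withDensity fX) U) =
      ∫⁻ y, (∫⁻ x : ℝ, omitMin (fun k => w (x + U k) y * fX (x + U k))) ∂ν := by
  set S : ℝ → ℝ≥0∞ := fun x => ∑ j, fX (x + U j)
  have hS : Measurable S := by fun_prop
  have hr : ∀ k, Measurable fun x => prior (volume.withDensity fX) U x k := fun k =>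
    Measure.measurable_rnDeriv _ _
  have hwk : ∀ k, Measurable fun p : ℝ × 𝒴 => w (p.1 + U k) p.2 := fun k =>
    hw.comp (f := fun p : ℝ × 𝒴 => (p.1 + U k, p.2)) (by fun_prop)
  have herr : ∀ x, minErrorProb (prior (volume.withDensity fX) U x) (fun k => W (x + U k)) =
      ∫⁻ y, omitMin (fun k => prior (volume.withDensity fX) U x k * w (x + U k) y) ∂ν := by
    intro x
    simp_rw [hW]
    exact minErrorProb_withDensity ν _ fun k => hw.of_uncurry_left
  have hmeas : Measurable fun p : ℝ × 𝒴 =>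
      omitMin (fun k => prior (volume.withDensity fX) U p.1 k * w (p.1 + U k) p.2) :=
    measurable_omitMin fun k => ((hr k).comp measurable_fst).mul (hwk k)
  have hSfin : ∀ᵐ x, S x ≠ ∞ := by
    have h : ∀ k, ∀ᵐ x, fX (x + U k) ≠ ∞ := fun k =>
      (quasiMeasurePreserving_add_right volume (U k)).ae
        ((ae_lt_top hfX hfin).mono fun x hx => hx.ne)
    filter_upwards [ae_all_iff.2 h] with x hx
    exact ENNReal.sum_ne_top.2 fun k _ => hx k
  simp_rw [herr]
  rw [shiftSum_withDensity hfX, lintegral_withDensity_eq_lintegral_mul _ hS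
    hmeas.lintegral_prod_right', ← lintegral_lintegral_swap]
  · refine lintegral_congr_ae ?_
    filter_upwards [hSfin, ae_all_iff.2 (sum_mul_prior_ae_eq hfX hfin U)] with x hx hp
    have hmx : Measurable fun y =>
        omitMin (fun k => prior (volume.withDensity fX) U x k * w (x + U k) y) :=
      hmeas.comp (f := fun y => (x, y)) (by fun_prop)
    rw [Pi.mul_apply, ← lintegral_const_mul _ hmx]
    refine lintegral_congr fun y => ?_
    rw [← omitMin_const_mul _ hx]
    congr 1
    ext k
    rw [← mul_assoc, hp, mul_comm]
  · have hmul : ∀ k, Measurable fun p : ℝ × 𝒴 => w (p.1 + U k) p.2 * fX (p.1 + U k) :=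
      fun k => (hwk k).fun_mul (by fun_prop)
    exact (measurable_omitMin hmul).aemeasurable

lemma ZZ_eq_lintegral {𝒴 : Type*} [MeasurableSpace 𝒴] {W : Kernel ℝ 𝒴}
    {ν : Measure 𝒴} [SigmaFinite ν] {w : ℝ → 𝒴 → ℝ≥0∞} (hw : Measurable (Function.uncurry w))
    (hW : ∀ x, W x = ν.withDensity (w x)) {fX : ℝ → ℝ≥0∞} (hfX : Measurable fX)
    (hfin : ∫⁻ x, fX x ≠ ∞) (N : ℕ) :
    ZZ (volume.withDensity fX) W (N + 1) =
      ∫⁻ y, zzFunctional N (fun x => w x y * fX x) ∂ν := by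
  have hh : ∀ t, hFun (volume.withDensity fX) W (N + 1) t =
      ∫⁻ y, overlap N (fun x => w x y * fX x) t ∂ν := by
    intro t
    -- the constraint leaves a single collection, so the supremum is trivial
    have hU : ∀ U : Fin (N + 1) → ℝ,
        (∀ k : Fin (N + 1), U k = ((k : ℕ) : ℝ) * t) ↔
          U = fun k : Fin (N + 1) => ((k : ℕ) : ℝ) * t :=
      fun U => funext_iff.symm
    simp_rw [hFun, hU]
    rw [iSup_iSup_eq_left, lintegral_minErrorProb_shiftSum hw hW hfX hfin]
    rfl
  have hmeas : Measurable fun p : ℝ × 𝒴 => overlap N (fun x => w x p.2 * fX x) p.1 := by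
    have hwk : ∀ k : Fin (N + 1), Measurable fun p : (ℝ × 𝒴) × ℝ =>
        w (p.2 + (k : ℕ) * p.1.1) p.1.2 := fun k =>
      hw.comp (f := fun p : (ℝ × 𝒴) × ℝ => (p.2 + (k : ℕ) * p.1.1, p.1.2)) (by fun_prop)
    have hmul : ∀ k : Fin (N + 1), Measurable fun p : (ℝ × 𝒴) × ℝ =>
        w (p.2 + (k : ℕ) * p.1.1) p.1.2 * fX (p.2 + (k : ℕ) * p.1.1) := fun k =>
      (hwk k).fun_mul (by fun_prop)
    exact (measurable_omitMin hmul).lintegral_prod_right'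
  have hsub : ((N + 1 : ℕ) : ℝ≥0∞) - 1 = N := by
    rw [Nat.cast_add, Nat.cast_one, ENNReal.add_sub_cancel_right ENNReal.one_ne_top]
  rw [ZZ, hsub]
  simp_rw [hh, zzFunctional]
  rw [lintegral_lintegral_swap]
  · refine lintegral_congr fun t => ?_
    have h1 : Measurable fun y => overlap N (fun x => w x y * fX x) t :=
      hmeas.comp (f := fun y => (t, y)) (by fun_prop)
    simp_rw [div_eq_mul_inv]
    rw [lintegral_const_mul _ (h1.mul_const _), lintegral_mul_const _ h1]
  · have h2 : Measurable fun p : 𝒴 × ℝ => overlap N (fun x => w x p.1 * fX x) p.2 :=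
      hmeas.comp (f := fun p : 𝒴 × ℝ => (p.2, p.1)) (by fun_prop)
    have h3 : Measurable fun p : 𝒴 × ℝ => ENNReal.ofReal (p.2 / 2) := by fun_prop
    exact (h3.fun_mul (h2.div_const _)).aemeasurable

/-! ### The mean minimizes the second moment -/

/-- The mean of the normalization of the density `f`. -/
noncomputable def densityMean (f : ℝ → ℝ≥0∞) : ℝ :=
  (∫ x, (f x).toReal * x) / (∫⁻ x, f x).toReal

lemma ae_eq_zero_of_mass_eq_zero {f : ℝ → ℝ≥0∞} (hf : Measurable f) (h : ∫⁻ x, f x = 0) :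
    ∀ᵐ x, f x = 0 :=
  (lintegral_eq_zero_iff hf).1 h

lemma mass_mul_densityMean {f : ℝ → ℝ≥0∞} (hf : Measurable f) (hfin : ∫⁻ x, f x ≠ ∞) :
    (∫⁻ x, f x).toReal * densityMean f = ∫ x, (f x).toReal * x := by
  by_cases h0 : ∫⁻ x, f x = 0
  · have : ∫ x, (f x).toReal * x = 0 := integral_eq_zero_of_ae <| by
      filter_upwards [ae_eq_zero_of_mass_eq_zero hf h0] with x hx
      simp [hx]
    simp [h0, this]
  · exact mul_div_cancel₀ _ (ENNReal.toReal_ne_zero.2 ⟨h0, hfin⟩)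

lemma momentAbout_eq_lintegral_ofReal {f : ℝ → ℝ≥0∞} (hfx : ∀ᵐ x, f x ≠ ∞) (b : ℝ) :
    momentAbout b f = ∫⁻ x, ENNReal.ofReal ((f x).toReal * (x - b) ^ 2) := by
  refine lintegral_congr_ae ?_
  filter_upwards [hfx] with x hx
  rw [mul_comm (f x).toReal, ENNReal.ofReal_mul (sq_nonneg _), ENNReal.ofReal_toReal hx]

lemma momentAbout_densityMean_le {f : ℝ → ℝ≥0∞} (hf : Measurable f) (hfin : ∫⁻ x, f x ≠ ∞)
    (hint : Integrable fun x => (f x).toReal * x) (b : ℝ) :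
    momentAbout (densityMean f) f ≤ momentAbout b f := by
  rcases eq_or_ne (momentAbout b f) ∞ with htop | htop
  · simp [htop]
  have hfx : ∀ᵐ x, f x ≠ ∞ := (ae_lt_top hf hfin).mono fun x hx => hx.ne
  have hmass : ∫ x, (f x).toReal = (∫⁻ x, f x).toReal :=
    integral_toReal hf.aemeasurable (ae_lt_top hf hfin)
  have hint0 : Integrable fun x => (f x).toReal :=
    integrable_toReal_of_lintegral_ne_top hf.aemeasurable hfin
  have hmean := mass_mul_densityMean hf hfin
  set a := densityMean f
  have hb : Integrable fun x => (f x).toReal * (x - b) ^ 2 := by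
    refine ⟨by fun_prop, ?_⟩
    rw [hasFiniteIntegral_iff_ofReal (Filter.Eventually.of_forall fun x => by positivity),
      ← momentAbout_eq_lintegral_ofReal hfx]
    exact htop.lt_top
  have hlin : Integrable fun x =>
      2 * (b - a) * ((f x).toReal * x) + (a ^ 2 - b ^ 2) * (f x).toReal :=
    (hint.const_mul _).add (hint0.const_mul _)
  have hexp : ∀ x, (f x).toReal * (x - a) ^ 2 = (f x).toReal * (x - b) ^ 2 +
      (2 * (b - a) * ((f x).toReal * x) + (a ^ 2 - b ^ 2) * (f x).toReal) := fun x => by ring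
  have ha : Integrable fun x => (f x).toReal * (x - a) ^ 2 := by
    simp_rw [hexp]
    exact hb.add hlin
  have hle : ∫ x, (f x).toReal * (x - a) ^ 2 ≤ ∫ x, (f x).toReal * (x - b) ^ 2 := by
    simp_rw [hexp]
    rw [integral_add hb hlin, integral_add (hint.const_mul _) (hint0.const_mul _),
      integral_const_mul, integral_const_mul, hmass, ← hmean]
    have : 0 ≤ (∫⁻ x, f x).toReal * (a - b) ^ 2 := by positivity
    nlinarith
  rw [momentAbout_eq_lintegral_ofReal hfx, momentAbout_eq_lintegral_ofReal hfx,
    ← ofReal_integral_eq_lintegral_ofReal ha (Filter.Eventually.of_forall fun x => by positivity),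
    ← ofReal_integral_eq_lintegral_ofReal hb (Filter.Eventually.of_forall fun x => by positivity)]
  exact ENNReal.ofReal_le_ofReal hle

/-! ### The minimum mean square error as a mixture over the observations -/

section joint

variable {Ω 𝒴 : Type*} [MeasurableSpace Ω] [m𝒴 : MeasurableSpace 𝒴] {μ : Measure Ω}
  {X : Ω → ℝ} {Y : Ω → 𝒴} {ν : Measure 𝒴} {f : 𝒴 → ℝ → ℝ≥0∞}

lemma map_prod_eq_withDensity [SigmaFinite ν] [IsProbabilityMeasure μ] (hX : Measurable X)
    (hY : Measurable Y)
    {W : Kernel ℝ 𝒴} [IsMarkovKernel W]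
    (hjoint : μ.map (fun ω => (X ω, Y ω)) = (μ.map X) ⊗ₘ W) {w : ℝ → 𝒴 → ℝ≥0∞}
    (hw : Measurable (Function.uncurry w)) (hW : ∀ x, W x = ν.withDensity (w x))
    {fX : ℝ → ℝ≥0∞} (hfX : Measurable fX) (hlaw : μ.map X = volume.withDensity fX) :
    μ.map (fun ω => (Y ω, X ω)) =
      (ν.prod volume).withDensity (Function.uncurry fun y x => w x y * fX x) := by
  have hf : Measurable (Function.uncurry fun y x => w x y * fX x) :=
    (hw.comp (f := fun p : 𝒴 × ℝ => (p.2, p.1)) (by fun_prop)).fun_mul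
      (hfX.comp measurable_snd)
  refine Measure.ext_of_lintegral _ fun F hF => ?_
  have hF' : Measurable fun p : ℝ × 𝒴 => F (p.2, p.1) := by fun_prop
  have hwF : Measurable fun p : ℝ × 𝒴 => w p.1 p.2 * F (p.2, p.1) := hw.fun_mul hF'
  have hwfF : Measurable fun p : ℝ × 𝒴 => fX p.1 * (w p.1 p.2 * F (p.2, p.1)) :=
    (hfX.comp measurable_fst).fun_mul hwF
  have hmap : ∫⁻ ω, F (Y ω, X ω) ∂μ = ∫⁻ p, F (p.2, p.1) ∂(μ.map fun ω => (X ω, Y ω)) := by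
    rw [lintegral_map hF' (by fun_prop)]
  rw [lintegral_map hF (by fun_prop), hmap, hjoint, Measure.lintegral_compProd hF', hlaw,
    lintegral_withDensity_eq_lintegral_mul _ hfX (hF'.lintegral_kernel_prod_right' (κ := W)),
    lintegral_withDensity_eq_lintegral_mul _ hf hF, lintegral_prod _ (hf.mul hF).aemeasurable]
  have hx : ∀ x, (fX * fun x => ∫⁻ y, F (y, x) ∂(W x)) x =
      ∫⁻ y, fX x * (w x y * F (y, x)) ∂ν := by
    intro x
    have h1 : Measurable fun y => F (y, x) := by fun_prop
    rw [Pi.mul_apply, hW, lintegral_withDensity_eq_lintegral_mul _ hw.of_uncurry_left h1,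
      lintegral_const_mul]
    · rfl
    · exact hwF.comp (f := fun y => (x, y)) (by fun_prop)
  simp_rw [hx]
  rw [lintegral_lintegral_swap hwfF.aemeasurable]
  refine lintegral_congr fun y => lintegral_congr fun x => ?_
  simp only [Pi.mul_apply, Function.uncurry_apply_pair]
  ring

lemma lintegral_joint (hX : Measurable X) (hY : Measurable Y) (hf : Measurable (Function.uncurry f))
    (hJ : μ.map (fun ω => (Y ω, X ω)) = (ν.prod volume).withDensity (Function.uncurry f))
    {F : 𝒴 × ℝ → ℝ≥0∞} (hF : Measurable F) :
    ∫⁻ ω, F (Y ω, X ω) ∂μ = ∫⁻ y, (∫⁻ x : ℝ, F (y, x) * f y x) ∂ν := by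
  rw [← lintegral_map hF (by fun_prop), hJ, lintegral_withDensity_eq_lintegral_mul _ hf hF,
    lintegral_prod _ (hf.mul hF).aemeasurable]
  simp only [Pi.mul_apply, Function.uncurry_apply_pair, mul_comm]

lemma map_eq_withDensity_marginal (hX : Measurable X) (hY : Measurable Y)
    (hf : Measurable (Function.uncurry f))
    (hJ : μ.map (fun ω => (Y ω, X ω)) = (ν.prod volume).withDensity (Function.uncurry f)) :
    μ.map Y = ν.withDensity fun y => ∫⁻ x, f y x := by
  have hfY : Measurable fun y => ∫⁻ x, f y x := hf.lintegral_prod_right'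
  refine Measure.ext_of_lintegral _ fun F hF => ?_
  rw [lintegral_map hF hY, lintegral_joint (F := fun p => F p.1) hX hY hf hJ (by fun_prop),
    lintegral_withDensity_eq_lintegral_mul _ hfY hF]
  refine lintegral_congr fun y => ?_
  change ∫⁻ x, F y * f y x = (∫⁻ x, f y x) * F y
  rw [lintegral_const_mul _ hf.of_uncurry_left, mul_comm]

lemma lintegral_marginal [IsProbabilityMeasure μ] (hX : Measurable X) (hY : Measurable Y)
    (hf : Measurable (Function.uncurry f))
    (hJ : μ.map (fun ω => (Y ω, X ω)) = (ν.prod volume).withDensity (Function.uncurry f)) :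
    ∫⁻ y, (∫⁻ x : ℝ, f y x) ∂ν = 1 := by
  have h := lintegral_joint (F := fun _ => 1) hX hY hf hJ measurable_const
  simpa using h.symm

lemma integrable_joint [SigmaFinite ν] [IsProbabilityMeasure μ] (hX : Measurable X)
    (hY : Measurable Y)
    (hf : Measurable (Function.uncurry f))
    (hJ : μ.map (fun ω => (Y ω, X ω)) = (ν.prod volume).withDensity (Function.uncurry f))
    (hint : Integrable X μ) :
    Integrable (fun p : 𝒴 × ℝ => (f p.1 p.2).toReal * p.2) (ν.prod volume) := by
  have hfin : ∀ᵐ p ∂(ν.prod volume), Function.uncurry f p < ∞ := by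
    refine ae_lt_top hf ?_
    rw [lintegral_prod _ hf.aemeasurable]
    exact (lintegral_marginal hX hY hf hJ).trans_ne ENNReal.one_ne_top
  refine (integrable_withDensity_iff_integrable_smul' hf hfin).1 ?_
  rw [← hJ]
  exact (integrable_map_measure measurable_snd.aestronglyMeasurable (by fun_prop)).2 hint

lemma measurable_densityMean (hf : Measurable (Function.uncurry f)) :
    Measurable fun y => densityMean (f y) := by
  have h : Measurable fun p : 𝒴 × ℝ => (f p.1 p.2).toReal * p.2 :=
    hf.ennreal_toReal.fun_mul measurable_snd
  exact h.stronglyMeasurable.integral_prod_right'.measurable.div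
    hf.lintegral_prod_right'.ennreal_toReal

/-- The conditional mean is the posterior mean. -/
lemma condExp_ae_eq_densityMean [SigmaFinite ν] [IsProbabilityMeasure μ] (hX : Measurable X)
    (hY : Measurable Y)
    (hf : Measurable (Function.uncurry f))
    (hJ : μ.map (fun ω => (Y ω, X ω)) = (ν.prod volume).withDensity (Function.uncurry f))
    (hint : Integrable X μ) :
    μ[X | m𝒴.comap Y] =ᵐ[μ] fun ω => densityMean (f (Y ω)) := by
  have hmarg := lintegral_marginal hX hY hf hJ
  have hfY : Measurable fun y => ∫⁻ x, f y x := hf.lintegral_prod_right'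
  have hfYfin : ∀ᵐ y ∂ν, ∫⁻ x, f y x < ∞ := ae_lt_top hfY (hmarg.trans_ne ENNReal.one_ne_top)
  have hfin : ∀ᵐ p ∂(ν.prod volume), Function.uncurry f p < ∞ := by
    refine ae_lt_top hf ?_
    rw [lintegral_prod _ hf.aemeasurable]
    exact hmarg.trans_ne ENNReal.one_ne_top
  have hj := integrable_joint hX hY hf hJ hint
  have hmean : ∀ᵐ y ∂ν, (∫⁻ x, f y x).toReal * densityMean (f y) = ∫ x, (f y x).toReal * x := by
    filter_upwards [hfYfin] with y hy
    exact mass_mul_densityMean hf.of_uncurry_left hy.ne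
  have hmY := map_eq_withDensity_marginal hX hY hf hJ
  have hmm := measurable_densityMean hf
  have hI : Integrable (fun ω => densityMean (f (Y ω))) μ := by
    refine (integrable_map_measure hmm.aestronglyMeasurable hY.aemeasurable).1 ?_
    rw [hmY, integrable_withDensity_iff_integrable_smul' hfY hfYfin]
    exact hj.integral_prod_left.congr (hmean.mono fun y hy => hy.symm)
  refine (ae_eq_condExp_of_forall_setIntegral_eq hY.comap_le hint (fun s _ _ => hI.integrableOn)
    ?_ (hmm.comp (comap_measurable Y)).aestronglyMeasurable).symm
  rintro _ ⟨s, hs, rfl⟩ -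
  have h1 : ∫ ω in Y ⁻¹' s, densityMean (f (Y ω)) ∂μ =
      ∫ y in s, (∫ x : ℝ, (f y x).toReal * x) ∂ν := by
    rw [← setIntegral_map (f := fun y => densityMean (f y)) hs hmm.aestronglyMeasurable
      hY.aemeasurable, hmY, setIntegral_withDensity_eq_setIntegral_toReal_smul hfY
      (ae_restrict_of_ae hfYfin) _ hs]
    exact integral_congr_ae (ae_restrict_of_ae hmean)
  have h2 : ∫ ω in Y ⁻¹' s, X ω ∂μ =
      ∫ p in s ×ˢ univ, p.2 ∂(μ.map fun ω => (Y ω, X ω)) := by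
    rw [setIntegral_map (hs.prod MeasurableSet.univ) measurable_snd.aestronglyMeasurable
      (by fun_prop)]
    congr 2
    ext ω
    simp
  rw [h1, h2, hJ, setIntegral_withDensity_eq_setIntegral_toReal_smul hf
    (ae_restrict_of_ae hfin) _ (hs.prod MeasurableSet.univ)]
  refine Eq.symm ((setIntegral_prod _ hj.integrableOn).trans ?_)
  simp only [Measure.restrict_univ]

lemma mmse_eq_lintegral [SigmaFinite ν] [IsProbabilityMeasure μ] (hX : Measurable X)
    (hY : Measurable Y) (hf : Measurable (Function.uncurry f))
    (hJ : μ.map (fun ω => (Y ω, X ω)) = (ν.prod volume).withDensity (Function.uncurry f))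
    (hint : Integrable X μ) :
    mmse μ X Y = ∫⁻ y, momentAbout (densityMean (f y)) (f y) ∂ν := by
  have hmm := measurable_densityMean hf
  have hF : Measurable fun p : 𝒴 × ℝ => ENNReal.ofReal ((p.2 - densityMean (f p.1)) ^ 2) :=
    ((measurable_snd.sub (hmm.comp measurable_fst)).pow_const 2).ennreal_ofReal
  refine Eq.trans (lintegral_congr_ae ?_) (lintegral_joint hX hY hf hJ hF)
  filter_upwards [condExp_ae_eq_densityMean hX hY hf hJ hint] with ω hω
  rw [hω]

end joint

/-! ### Equality in the bound -/

/-- For a single density, the Ziv–Zakai functional equals the variance term exactly when the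
density is unimodal and symmetric. Since the mode need not be known to be the mean beforehand, the
reverse direction compares the second moments about the two points. -/
lemma momentAbout_densityMean_eq_iff {N : ℕ} (hN : N ≠ 0) {f : ℝ → ℝ≥0∞} (hf : Measurable f)
    (hfin : ∫⁻ x, f x ≠ ∞) (hint : Integrable fun x => (f x).toReal * x)
    (hV : momentAbout (densityMean f) f ≠ ∞) :
    momentAbout (densityMean f) f = zzFunctional N f ↔ IsUnimodalSymmetricDensity f := by
  refine ⟨fun h => isUnimodalSymmetricDensity_of_momentAbout_le hN hf hfin (h ▸ hV) h.le, ?_⟩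
  rintro ⟨g, m, hfg, hg, hs⟩
  -- the second moment about the mode dominates the one about the mean, and the bound attains it
  refine le_antisymm ?_ (zzFunctional_le_momentAbout N hf _)
  rw [zzFunctional_eq_of_unimodal hN hf ((ae_lt_top hf hfin).mono fun x hx => hx.ne) hfg hg hs]
  exact momentAbout_densityMean_le hf hfin hint m

lemma isUnimodalSymmetricDensity_of_mass_eq_zero {f : ℝ → ℝ≥0∞} (hf : Measurable f)
    (h : ∫⁻ x, f x = 0) : IsUnimodalSymmetricDensity f :=
  ⟨fun _ => 0, 0, ae_eq_zero_of_mass_eq_zero hf h, ⟨monotoneOn_const, antitoneOn_const⟩,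
    fun _ => rfl⟩

lemma isUnimodalSymmetricDensity_div_mass_iff {f : ℝ → ℝ≥0∞} (h0 : ∫⁻ x, f x ≠ 0)
    (hfin : ∫⁻ x, f x ≠ ∞) : IsUnimodalSymmetricDensity (fun x => f x / ∫⁻ x', f x') ↔
      IsUnimodalSymmetricDensity f := by
  refine ⟨fun h => ?_, fun h => ?_⟩
  · convert h.const_mul (∫⁻ x, f x) using 2 with x
    rw [ENNReal.mul_div_cancel h0 hfin]
  · convert h.const_mul (∫⁻ x, f x)⁻¹ using 2 with x
    rw [div_eq_mul_inv, mul_comm]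

end ZivZakai

theorem mainTheorem5 {Ω 𝒴 : Type*} [MeasurableSpace Ω] [MeasurableSpace 𝒴]
    (μ : Measure Ω) [IsProbabilityMeasure μ]
    (X : Ω → ℝ) (Y : Ω → 𝒴) (hX : Measurable X) (hY : Measurable Y)
    -- `X` is a continuous random variable: it has a density with respect to Lebesgue measure
    (hpdf : HasPDF X μ volume)
    -- the channel `P_{Y|X}` is `W`
    (W : Kernel ℝ 𝒴) [IsMarkovKernel W]
    (hjoint : μ.map (fun ω => (X ω, Y ω)) = (μ.map X) ⊗ₘ W)
    -- the channel has a density `w x y = f_{Y|X}(y|x)` with respect to a reference measure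
    (ν : Measure 𝒴) [SigmaFinite ν]
    (w : ℝ → 𝒴 → ℝ≥0∞) (hw : Measurable (Function.uncurry w))
    (hW : ∀ x, W x = ν.withDensity (w x))
    -- the conditional mean exists and the mmse is finite
    (hint : Integrable X μ) (hfin : ZivZakai.mmse μ X Y ≠ ∞)
    (M : ℕ) (hM : 2 ≤ M) :
    ZivZakai.mmse μ X Y = ZivZakai.ZZ (μ.map X) W M ↔
      ∀ᵐ y ∂(μ.map Y),
        ZivZakai.IsUnimodalSymmetricDensity
          (ZivZakai.posteriorDensity (pdf X μ volume) w y) := by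
  open ZivZakai in
  obtain ⟨N, rfl⟩ : ∃ N, M = N + 1 := ⟨M - 1, by omega⟩
  have hN : N ≠ 0 := by omega
  have hfX : Measurable (pdf X μ volume) := measurable_pdf X μ volume
  have hlaw : μ.map X = volume.withDensity (pdf X μ volume) := map_eq_withDensity_pdf X μ volume
  have hfXfin : ∫⁻ x, pdf X μ volume x ≠ ∞ :=
    ((setLIntegral_univ _).symm.trans (by
      rw [← withDensity_apply _ MeasurableSet.univ, ← hlaw, Measure.map_apply hX .univ,
        preimage_univ, measure_univ])).trans_ne ENNReal.one_ne_top
  set f : 𝒴 → ℝ → ℝ≥0∞ := fun y x => w x y * pdf X μ volume x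
  have hf : Measurable (Function.uncurry f) :=
    (hw.comp (f := fun p : 𝒴 × ℝ => (p.2, p.1)) (by fun_prop)).fun_mul
      (hfX.comp measurable_snd)
  have hfy : ∀ y, Measurable (f y) := fun y => hf.of_uncurry_left
  have hJ := map_prod_eq_withDensity hX hY hjoint hw hW hfX hlaw
  have hmmse := mmse_eq_lintegral hX hY hf hJ hint
  have hZZ : ZZ (μ.map X) W (N + 1) = ∫⁻ y, zzFunctional N (f y) ∂ν := by
    rw [hlaw]
    exact ZZ_eq_lintegral hw hW hfX hfXfin N
  have hmarg : Measurable fun y => ∫⁻ x, f y x := hf.lintegral_prod_right'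
  have hmargfin : ∀ᵐ y ∂ν, ∫⁻ x, f y x < ∞ :=
    ae_lt_top hmarg ((lintegral_marginal hX hY hf hJ).trans_ne ENNReal.one_ne_top)
  have hV : Measurable fun y => momentAbout (densityMean (f y)) (f y) := by
    have h : Measurable fun p : 𝒴 × ℝ => ENNReal.ofReal ((p.2 - densityMean (f p.1)) ^ 2) :=
      ((measurable_snd.sub ((measurable_densityMean hf).comp measurable_fst)).pow_const
        2).ennreal_ofReal
    exact (h.fun_mul hf).lintegral_prod_right'
  rw [hmmse] at hfin
  have hiff : ∀ᵐ y ∂ν, (zzFunctional N (f y) = momentAbout (densityMean (f y)) (f y) ↔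
      (∫⁻ x, f y x ≠ 0 → IsUnimodalSymmetricDensity (posteriorDensity (pdf X μ volume) w y))) := by
    filter_upwards [hmargfin, ae_lt_top hV hfin, (integrable_joint hX hY hf hJ hint).prod_right_ae]
      with y hy hVy hinty
    rw [eq_comm, momentAbout_densityMean_eq_iff hN (hfy y) hy.ne hinty hVy.ne]
    by_cases h0 : ∫⁻ x, f y x = 0
    · simp [h0, isUnimodalSymmetricDensity_of_mass_eq_zero (hfy y) h0]
    · simp only [ne_eq, h0, not_false_eq_true, forall_const]
      exact (isUnimodalSymmetricDensity_div_mass_iff h0 hy.ne).symm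
  have hle : ∀ y, zzFunctional N (f y) ≤ momentAbout (densityMean (f y)) (f y) := fun y =>
    zzFunctional_le_momentAbout N (hfy y) _
  rw [map_eq_withDensity_marginal hX hY hf hJ, ae_withDensity_iff hmarg,
    ← Filter.eventually_congr hiff, hmmse, hZZ]
  refine ⟨fun h => ?_, fun h => lintegral_congr_ae (h.mono fun y hy => hy.symm)⟩
  exact ae_eq_of_ae_le_of_lintegral_le (Filter.Eventually.of_forall hle) (h ▸ hfin)
    hV.aemeasurable h.le
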